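/- Let $U$ and $X$ be complex Banach spaces and let $A$ be the generator of a strongly continuous semigroup $\mathbb T=(T(t))_{t\ge 0}$ on $X$ with growth bound $\omega(\mathbb T)=\inf\{w\in\mathbb R:\sup_{t>0}e^{-wt}\|T(t)\|<\infty\}\in[-\infty,\infty)$. For a fixed $\beta\in\rho(A)$ let $X_1$ be $D(A)$ with the norm $\|(\beta-A)x\|_X$, and let $X_{-1}$ be the completion of $X$ for the norm $\|(\beta-A)^{-1}x\|_X$. The continuous extensions of $T(t)$ and of $(\lambda-A)^{-1}$, $\lambda\in\rho(A)$, to $X_{-1}$ are denoted by $T_{-1}(t)$ and $R(\lambda)\in L(X_{-1},X)$; $A_{-1}:X\to X_{-1}$ is the generator of $(T_{-1}(t))_{t\ge0}$ and extends $A$. Put $\mathbb C_\omega=\{z\in\mathbb C:\operatorname{Re}z>\omega(\mathbb T)\}$. Let $\Sigma(A,B,\mathbb I,\mathbf G)$ be a system node on $(U,X,X)$ whose output operator is the inclusion $\mathbb I:X_1\to X$; that is, $B\in L(U,X_{-1})$, and $\mathbf G:\mathbb C_\omega\to L(U,X)$ is analytic with $\mathbf G(\lambda)-\mathbf G(\mu)=[R(\lambda)-R(\mu)]B$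 for all $\lambda,\mu\in\mathbb C_\omega$. On $D(C\&D)=\{(x,u)\in X\times U: A_{-1}x+Bu\in X\}$ put $(C\&D)(x,u)=x-R(\lambda)Bu+\mathbf G(\lambda)u$ with any $\lambda\in\mathbb C_\omega$. Let $\Phi_tu=\int_0^tT_{-1}(t-s)Bu(s)\,ds\in X_{-1}$. For $1\le p\le\infty$, $B$ is $L^p$-control-admissible if for every $t>0$ the map $\Phi_t$ sends $L^p([0,\infty),U)$ into $X$ and is bounded from $L^p([0,\infty),U)$ to $X$; it is infinite-time $L^p$-control-admissible if moreover $\sup_{t>0}\|\Phi_t\|_{L(L^p([0,\infty),U),X)}<\infty$. The semigroup is exponentially stable if $\omega(\mathbb T)<0$. A generalised solution of the node is a triple $(u,x,y)$ with $u\in L^1_{\mathrm{loc}}([0,\infty),U)$, $x\in C([0,\infty),X_{-1})$, $x(t)=T_{-1}(t)x_0+\Phi_tu$ for some $x_0\in X$ and all $t\ge0$, and $y$ the $X$-valued distribution $$y(\varphi)=\int_0^\infty\Big\langle\varphi''(t),\,(C\&D)\int_0^t(t-s)\begin{bmatrix}x(s)\\u(s)\end{bmatrix}ds\Big\rangle dt,\qquad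 \varphi\in C_c^\infty([0,\infty),X').$$ The node is $L^\infty$-BIBO stable if there is $c>0$ such that for every generalised solution $(u,x,y)$ with $u\in L^\infty_{\mathrm{loc}}([0,\infty),U)$ and $x(0)=0$ one has $y\in L^\infty_{\mathrm{loc}}([0,\infty),X)$ and $\|y\|_{L^\infty([0,t],X)}\le c\,\|u\|_{L^\infty([0,t],U)}$ for all $t>0$. Then: 1. If $B$ is infinite-time $L^\infty$-control-admissible, then $\Sigma(A,B,\mathbb I,\mathbf G)$ is $L^\infty$-BIBO stable. 2. In particular, $\Sigma(A,B,\mathbb I,\mathbf G)$ is $L^\infty$-BIBO stable if $B$ is $L^p$-control-admissible for some $1\le p\le\infty$ and $\mathbb T$ is exponentially stable. -/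

import Mathlib

open MeasureTheory Filter Topology
open scoped NNReal ENNReal ContDiff

noncomputable section

/-- A strongly continuous semigroup of bounded linear operators on a complex normed space. -/
structure C0Semigroup (X : Type*) [NormedAddCommGroup X] [NormedSpace ℂ X] where
  op : ℝ≥0 → X →L[ℂ] X
  op_zero : op 0 = ContinuousLinearMap.id ℂ X
  op_add : ∀ s t : ℝ≥0, op (s + t) = (op s).comp (op t)
  tendsto_op : ∀ x : X, Tendsto (fun t : ℝ≥0 => op t x) (𝓝 0) (𝓝 x)

namespace C0Semigroup

section Basic

variable {X : Type*} [NormedAddCommGroup X] [NormedSpace ℂ X] (S : C0Semigroup X)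

/-- `y` is the right derivative at `0` of the orbit of `x`. -/
def IsGeneratorValue (x y : X) : Prop :=
  Tendsto (fun h : ℝ≥0 => (h : ℝ)⁻¹ • (S.op h x - x)) (𝓝[>] 0) (𝓝 y)

variable {S} in
theorem IsGeneratorValue.add {x y x' y' : X} (h : S.IsGeneratorValue x y)
    (h' : S.IsGeneratorValue x' y') : S.IsGeneratorValue (x + x') (y + y') := by
  refine (Tendsto.add h h').congr fun t => ?_
  rw [← smul_add, map_add]
  congr 1
  abel

variable {S} in
theorem IsGeneratorValue.smul (c : ℂ) {x y : X} (h : S.IsGeneratorValue x y) :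
    S.IsGeneratorValue (c • x) (c • y) := by
  refine (Tendsto.const_smul h c).congr fun t => ?_
  rw [smul_comm, smul_sub, map_smul]

variable {S} in
theorem IsGeneratorValue.unique {x y y' : X} (h : S.IsGeneratorValue x y)
    (h' : S.IsGeneratorValue x y') : y = y' :=
  tendsto_nhds_unique h h'

/-- The domain `D(A)` of the generator. -/
def domain : Submodule ℂ X where
  carrier := {x | ∃ y, S.IsGeneratorValue x y}
  add_mem' := fun ⟨_, h⟩ ⟨_, h'⟩ => ⟨_, h.add h'⟩
  zero_mem' := ⟨0, by simp [IsGeneratorValue]⟩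
  smul_mem' := fun c _ ⟨_, h⟩ => ⟨_, h.smul c⟩

/-- The generator `A : D(A) ⊆ X → X` of the semigroup. -/
def generator : X →ₗ.[ℂ] X where
  domain := S.domain
  toFun :=
    { toFun := fun x => x.2.choose
      map_add' := fun x y =>
        (x + y).2.choose_spec.unique (x.2.choose_spec.add y.2.choose_spec)
      map_smul' := fun c x =>
        (c • x).2.choose_spec.unique (x.2.choose_spec.smul c) }

theorem generator_spec (x : S.generator.domain) : S.IsGeneratorValue (x : X) (S.generator x) :=
  x.2.choose_spec

/-- The bounded operator `R` is the inverse of `l - A : D(A) → X`. -/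
def IsResolventAt (l : ℂ) (R : X →L[ℂ] X) : Prop :=
  (∀ x : X, ∃ h : R x ∈ S.generator.domain, l • R x - S.generator ⟨R x, h⟩ = x) ∧
    ∀ x : S.generator.domain, R (l • (x : X) - S.generator x) = x

/-- The resolvent set `ρ(A)` of the generator. -/
def resolventSet : Set ℂ := {l | ∃ R, S.IsResolventAt l R}

open scoped Classical in
/-- The resolvent `R(l, A) = (l - A)⁻¹` for `l ∈ ρ(A)` (and `0` for other `l`). -/
def res (l : ℂ) : X →L[ℂ] X := if h : ∃ R, S.IsResolventAt l R then h.choose else 0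

theorem res_spec {l : ℂ} (hl : l ∈ S.resolventSet) : S.IsResolventAt l (S.res l) := by
  have h : ∃ R, S.IsResolventAt l R := hl
  rw [res, dif_pos h]
  exact h.choose_spec

theorem res_injective {l : ℂ} (hl : l ∈ S.resolventSet) : Function.Injective (S.res l) := by
  intro x y hxy
  obtain ⟨h, hx⟩ := (S.res_spec hl).1 x
  obtain ⟨h', hy⟩ := (S.res_spec hl).1 y
  rw [← hx, ← hy]
  simp only [hxy]

/-- The growth bound `ω(𝕋) = inf {w ∈ ℝ | sup_{t > 0} e^{-wt} ‖T(t)‖ < ∞}`, possibly `-∞`. -/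
def growthBound : EReal :=
  sInf ((fun w : ℝ => (w : EReal)) ''
    {w : ℝ | BddAbove {r : ℝ | ∃ t : ℝ≥0, 0 < t ∧ r = Real.exp (-(t : ℝ) * w) * ‖S.op t‖}})

def ExponentiallyStable : Prop := S.growthBound < 0

/-- The open half-plane of all complex numbers with real part larger than the growth bound. -/
def halfPlane : Set ℂ := {z | S.growthBound < (z.re : EReal)}

theorem op_mem_domain (t : ℝ≥0) (x : S.generator.domain) :
    S.IsGeneratorValue (S.op t x) (S.op t (S.generator x)) := by
  refine (((S.op t).continuous.tendsto _).comp (S.generator_spec x)).congr fun h => ?_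
  simp only [Function.comp]
  rw [ContinuousLinearMap.map_smul_of_tower, map_sub, ← ContinuousLinearMap.comp_apply,
    ← S.op_add, add_comm t h, S.op_add, ContinuousLinearMap.comp_apply]

/-- The semigroup commutes with the resolvent. -/
theorem res_op {l : ℂ} (hl : l ∈ S.resolventSet) (t : ℝ≥0) (x : X) :
    S.res l (S.op t x) = S.op t (S.res l x) := by
  obtain ⟨h, hx⟩ := (S.res_spec hl).1 x
  have hg := S.op_mem_domain t ⟨S.res l x, h⟩
  have h2 := (S.res_spec hl).2 ⟨S.op t (S.res l x), ⟨_, hg⟩⟩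
  rw [(S.generator_spec ⟨S.op t (S.res l x), ⟨_, hg⟩⟩).unique hg] at h2
  dsimp only at h2 hg
  rw [← h2]
  conv_lhs => rw [← hx]
  rw [map_sub, map_smul]

/-- The resolvent identity. -/
theorem res_identity {l b : ℂ} (hl : l ∈ S.resolventSet) (hb : b ∈ S.resolventSet) (x : X) :
    S.res l x = S.res b x + (b - l) • S.res l (S.res b x) := by
  obtain ⟨h, hx⟩ := (S.res_spec hb).1 x
  have h2 := (S.res_spec hl).2 ⟨S.res b x, h⟩
  dsimp only at h2
  have h3 : x = (l • S.res b x - S.generator ⟨S.res b x, h⟩) + (b - l) • S.res b x := by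
    conv_lhs => rw [← hx]
    rw [sub_smul]
    abel
  conv_lhs => rw [h3]
  rw [map_add, h2, map_smul]

theorem exists_res_bound (l : ℂ) {b : ℂ} (hb : b ∈ S.resolventSet) :
    ∃ K : ℝ, ∀ x : X, ‖S.res l x‖ ≤ K * ‖S.res b x‖ := by
  by_cases hl : l ∈ S.resolventSet
  · refine ⟨1 + ‖b - l‖ * ‖S.res l‖, fun x => ?_⟩
    rw [S.res_identity hl hb x]
    refine (norm_add_le _ _).trans ?_
    rw [norm_smul, add_mul, one_mul, mul_assoc]
    gcongr
    exact (S.res l).le_opNorm _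
  · refine ⟨0, fun x => ?_⟩
    have : S.res l = 0 := by
      rw [res, dif_neg]
      exact hl
    simp [this]

end Basic

section Spaces

variable {X : Type*} [NormedAddCommGroup X] [NormedSpace ℂ X] (S : C0Semigroup X)

/-- The vector space `D(A)`, to be normed by `‖x‖₁ = ‖(b - A) x‖`. -/
def Interp (_b : S.resolventSet) : Type _ := S.generator.domain

/-- The vector space `X`, to be normed by `‖x‖₋₁ = ‖(b - A)⁻¹ x‖`. -/
def PreExtrap (_b : S.resolventSet) : Type _ := X

variable (b : S.resolventSet)

instance : AddCommGroup (S.Interp b) := inferInstanceAs (AddCommGroup S.generator.domain)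
instance : Module ℂ (S.Interp b) := inferInstanceAs (Module ℂ S.generator.domain)
instance : AddCommGroup (S.PreExtrap b) := inferInstanceAs (AddCommGroup X)
instance : Module ℂ (S.PreExtrap b) := inferInstanceAs (Module ℂ X)

/-- The inclusion `X₁ → X`. -/
def interpVal : S.Interp b →ₗ[ℂ] X := S.generator.domain.subtype

/-- The map `b - A : X₁ → X`. -/
def interpMap : S.Interp b →ₗ[ℂ] X :=
  (b : ℂ) • S.generator.domain.subtype - S.generator.toFun

theorem res_interpMap (x : S.Interp b) : S.res b (S.interpMap b x) = S.interpVal b x :=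
  (S.res_spec b.2).2 x

theorem interpMap_injective : Function.Injective (S.interpMap b) := by
  intro x y h
  have := congrArg (S.res b) h
  rw [res_interpMap, res_interpMap] at this
  exact Subtype.ext this

/-- The map `(b - A)⁻¹` as a linear map on the pre-completion of `X₋₁`. -/
def preExtrapMap : S.PreExtrap b →ₗ[ℂ] X := (S.res b).toLinearMap

theorem preExtrapMap_injective : Function.Injective (S.preExtrapMap b) :=
  S.res_injective b.2

/-- `‖x‖₁ = ‖(b - A) x‖`. -/
instance : NormedAddCommGroup (S.Interp b) :=
  NormedAddCommGroup.induced _ _ (S.interpMap b) (S.interpMap_injective b)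

instance : NormedSpace ℂ (S.Interp b) := NormedSpace.induced ℂ _ _ (S.interpMap b)

/-- `‖x‖₋₁ = ‖(b - A)⁻¹ x‖`. -/
instance : NormedAddCommGroup (S.PreExtrap b) :=
  NormedAddCommGroup.induced _ _ (S.preExtrapMap b) (S.preExtrapMap_injective b)

instance : NormedSpace ℂ (S.PreExtrap b) := NormedSpace.induced ℂ _ _ (S.preExtrapMap b)

/-- The extrapolation space `X₋₁`, the completion of `X` for the norm `‖(b - A)⁻¹ x‖`. -/
def Extrap : Type _ := UniformSpace.Completion (S.PreExtrap b)

instance : NormedAddCommGroup (S.Extrap b) :=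
  inferInstanceAs (NormedAddCommGroup (UniformSpace.Completion (S.PreExtrap b)))
instance : NormedSpace ℂ (S.Extrap b) :=
  inferInstanceAs (NormedSpace ℂ (UniformSpace.Completion (S.PreExtrap b)))
instance : CompleteSpace (S.Extrap b) :=
  inferInstanceAs (CompleteSpace (UniformSpace.Completion (S.PreExtrap b)))

theorem norm_preExtrap (x : S.PreExtrap b) : ‖x‖ = ‖S.res b x‖ := rfl

/-- The dense embedding `X → X₋₁`. -/
def incl : X →ₗ[ℂ] S.Extrap b :=
  (UniformSpace.Completion.toComplL (𝕜 := ℂ) (E := S.PreExtrap b)).toLinearMap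

theorem norm_incl (x : X) : ‖S.incl b x‖ = ‖S.res b x‖ :=
  UniformSpace.Completion.norm_coe (E := S.PreExtrap b) x

theorem denseRange_incl : DenseRange (S.incl b) :=
  UniformSpace.Completion.denseRange_coe (α := S.PreExtrap b)

/-- The bounded operator `T(t)` for the norm of `X₋₁`. -/
def preOp (t : ℝ≥0) : S.PreExtrap b →L[ℂ] S.PreExtrap b :=
  LinearMap.mkContinuous (σ := RingHom.id ℂ) (E := S.PreExtrap b) (F := S.PreExtrap b)
    (S.op t).toLinearMap ‖S.op t‖ fun x => by
      change ‖S.res b (S.op t x)‖ ≤ ‖S.op t‖ * ‖S.res b x‖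
      exact (congrArg norm (S.res_op b.2 t x)).trans_le ((S.op t).le_opNorm _)

/-- The extension `T₋₁(t)` of `T(t)` to `X₋₁` by continuity. -/
def extOp (t : ℝ≥0) : S.Extrap b →L[ℂ] S.Extrap b := (S.preOp b t).completion

theorem extOp_incl (t : ℝ≥0) (x : X) : S.extOp b t (S.incl b x) = S.incl b (S.op t x) :=
  ContinuousLinearMap.completion_apply_coe (S.preOp b t) x

theorem extrap_induction {p : S.Extrap b → Prop} (hp : IsClosed {z | p z})
    (h : ∀ x : X, p (S.incl b x)) (z : S.Extrap b) : p z :=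
  (S.denseRange_incl b).induction_on z hp h

variable [CompleteSpace X]

/-- The resolvent `R(l, A)` as a bounded operator for the norm of `X₋₁`. -/
def preRes (l : ℂ) : S.PreExtrap b →L[ℂ] X :=
  LinearMap.mkContinuousOfExistsBound (σ := RingHom.id ℂ) (E := S.PreExtrap b)
    (S.res l).toLinearMap (S.exists_res_bound l b.2)

/-- The extension of the resolvent `R(l, A)` to a bounded operator `X₋₁ → X`. -/
def extRes (l : ℂ) : S.Extrap b →L[ℂ] X := (S.preRes b l).fromCompletion

theorem extRes_incl (l : ℂ) (x : X) : S.extRes b l (S.incl b x) = S.res l x :=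
  ContinuousLinearMap.fromCompletion_apply_coe (S.preRes b l) x

theorem norm_extRes (z : S.Extrap b) : ‖S.extRes b b z‖ = ‖z‖ := by
  refine S.extrap_induction b (p := fun z => ‖S.extRes b b z‖ = ‖z‖) ?_ (fun x => ?_) z
  · exact isClosed_eq (S.extRes b b).continuous.norm continuous_norm
  · rw [extRes_incl, norm_incl]

theorem extRes_extOp (t : ℝ≥0) (z : S.Extrap b) :
    S.extRes b b (S.extOp b t z) = S.op t (S.extRes b b z) := by
  refine S.extrap_induction b
    (p := fun z => S.extRes b b (S.extOp b t z) = S.op t (S.extRes b b z)) ?_ (fun x => ?_) z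
  · exact isClosed_eq ((S.extRes b b).continuous.comp (S.extOp b t).continuous)
      ((S.op t).continuous.comp (S.extRes b b).continuous)
  · rw [extOp_incl, extRes_incl, extRes_incl, S.res_op b.2]

theorem extRes_injective : Function.Injective (S.extRes b b) :=
  (injective_iff_map_eq_zero _).2 fun z hz => by rw [← norm_eq_zero, ← S.norm_extRes b, hz, norm_zero]

/-- The extended semigroup `𝕋₋₁` on `X₋₁`; its generator is `A₋₁`. -/
def extSemigroup : C0Semigroup (S.Extrap b) where
  op := S.extOp b
  op_zero := by
    ext z
    apply S.extRes_injective b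
    rw [extRes_extOp, S.op_zero]
    rfl
  op_add := fun s t => by
    ext z
    apply S.extRes_injective b
    rw [ContinuousLinearMap.comp_apply, extRes_extOp, extRes_extOp, extRes_extOp, S.op_add]
    rfl
  tendsto_op := fun z => by
    rw [tendsto_iff_norm_sub_tendsto_zero]
    refine (tendsto_iff_norm_sub_tendsto_zero.1 (S.tendsto_op (S.extRes b b z))).congr fun t => ?_
    rw [← extRes_extOp, ← map_sub, norm_extRes]

section Admissible

variable {U : Type*} [NormedAddCommGroup U] [NormedSpace ℂ U] (B : U →L[ℂ] S.Extrap b)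

/-- The input map `Φ_t u = ∫_0^t T₋₁(t - s) B u(s) ds`, with values in `X₋₁`. -/
def inputMap (t : ℝ) (u : ℝ → U) : S.Extrap b :=
  ∫ s in (0 : ℝ)..t, (S.extSemigroup b).op (t - s).toNNReal (B (u s))

/-- `Φ_t` maps `L^p([0,∞), U)` into `X`, with operator norm at most `K`. -/
def InputMapBound (p : ℝ≥0∞) (t K : ℝ) : Prop :=
  ∀ u : ℝ → U, MemLp u p (volume.restrict (Set.Ici 0)) →
    ∃ x : X, S.incl b x = S.inputMap b B t u ∧
      ‖x‖ ≤ K * (eLpNorm u p (volume.restrict (Set.Ici 0))).toReal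

/-- `L^p`-control-admissibility of `B`. -/
def ControlAdmissible (p : ℝ≥0∞) : Prop :=
  ∀ t : ℝ, 0 < t → ∃ K : ℝ, S.InputMapBound b B p t K

/-- Infinite-time `L^p`-control-admissibility of `B`: the bound is uniform in `t`. -/
def InfiniteTimeControlAdmissible (p : ℝ≥0∞) : Prop :=
  ∃ K : ℝ, ∀ t : ℝ, 0 < t → S.InputMapBound b B p t K

end Admissible

end Spaces

end C0Semigroup

/-- A system node `Σ(A, B, C, G)` on `(U, X, Y)`. The generator `A` is given by its semigroup, and
`b` is the point of `ρ(A)` that is used in the norms of `X₁` and `X₋₁`. -/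
structure SystemNode (U X Y : Type*)
    [NormedAddCommGroup U] [NormedSpace ℂ U]
    [NormedAddCommGroup X] [NormedSpace ℂ X] [CompleteSpace X]
    [NormedAddCommGroup Y] [NormedSpace ℂ Y] where
  S : C0Semigroup X
  b : S.resolventSet
  B : U →L[ℂ] S.Extrap b
  C : S.Interp b →L[ℂ] Y
  /-- The transfer function; only its values on `S.halfPlane` matter. -/
  G : ℂ → U →L[ℂ] Y
  analytic_G : AnalyticOnNhd ℂ G S.halfPlane
  /-- `G(l) - G(m) = C [R(l, A) - R(m, A)] B`, where the bracket takes its values in `X₁`. -/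
  G_sub : ∀ l ∈ S.halfPlane, ∀ m ∈ S.halfPlane, ∀ u : U, ∃ z : S.Interp b,
    S.interpVal b z = S.extRes b l (B u) - S.extRes b m (B u) ∧ G l u - G m u = C z

section TestFunctions

variable (Y : Type*) [NormedAddCommGroup Y] [NormedSpace ℂ Y]

/-- `C_c^∞([0,∞), Y')`: functions that are smooth on `[0,∞)` (one-sidedly at `0`) and vanish for
large arguments; they are extended by `0` to negative arguments. -/
def testFunctions : Submodule ℂ (ℝ → StrongDual ℂ Y) where
  carrier := {φ | ContDiffOn ℝ ∞ φ (Set.Ici 0) ∧ (∀ t < 0, φ t = 0) ∧ ∃ r : ℝ, ∀ t > r, φ t = 0}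
  add_mem' := by
    rintro φ ψ ⟨h1, h2, r, h3⟩ ⟨k1, k2, q, k3⟩
    refine ⟨h1.add k1, fun t ht => by simp [h2 t ht, k2 t ht], max r q, fun t ht => ?_⟩
    simp [h3 t (lt_of_le_of_lt (le_max_left _ _) ht), k3 t (lt_of_le_of_lt (le_max_right _ _) ht)]
  zero_mem' := ⟨contDiffOn_const, fun _ _ => rfl, 0, fun _ _ => rfl⟩
  smul_mem' := by
    rintro c φ ⟨h1, h2, r, h3⟩
    exact ⟨h1.const_smul c, fun t ht => by simp [h2 t ht], r, fun t ht => by simp [h3 t ht]⟩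

/-- `Y`-valued distributions on `[0,∞)`: linear functionals on `C_c^∞([0,∞), Y')`. -/
abbrev VectorDistribution : Type _ := testFunctions Y →ₗ[ℂ] ℂ

variable {Y}

/-- The function `f`, restricted to `[0,∞)`, represents the distribution `y`. -/
def VectorDistribution.IsRepresentedBy (y : VectorDistribution Y) (f : ℝ → Y) : Prop :=
  ∀ φ : testFunctions Y, y φ = ∫ t in Set.Ici (0 : ℝ), (φ : ℝ → StrongDual ℂ Y) t (f t)

end TestFunctions

/-- `L^∞_loc([0,∞), E)`. -/
def MemLinftyLoc {E : Type*} [NormedAddCommGroup E] (f : ℝ → E) : Prop :=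
  ∀ T : ℝ, MemLp f ∞ (volume.restrict (Set.Icc 0 T))

/-- `L^1_loc([0,∞), E)`. -/
def MemL1Loc {E : Type*} [NormedAddCommGroup E] (f : ℝ → E) : Prop :=
  ∀ T : ℝ, MemLp f 1 (volume.restrict (Set.Icc 0 T))

namespace SystemNode

variable {U X Y : Type*}
  [NormedAddCommGroup U] [NormedSpace ℂ U]
  [NormedAddCommGroup X] [NormedSpace ℂ X] [CompleteSpace X]
  [NormedAddCommGroup Y] [NormedSpace ℂ Y]
  (N : SystemNode U X Y)

/-- `(x, u) ∈ D(C&D)`, that is `A₋₁ x + B u ∈ X`. -/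
def MemDomainCD (x : X) (u : U) : Prop :=
  ∃ h : N.S.incl N.b x ∈ (N.S.extSemigroup N.b).generator.domain, ∃ z : X,
    (N.S.extSemigroup N.b).generator ⟨N.S.incl N.b x, h⟩ + N.B u = N.S.incl N.b z

/-- `(x, u) ∈ D(C&D)` and `(C&D)(x, u) = y`, where
`(C&D)(x, u) = C [x - R(l, A) B u] + G(l) u` with `Re l > ω(𝕋)` (independently of `l`). -/
def IsValueCD (x : X) (u : U) (y : Y) : Prop :=
  N.MemDomainCD x u ∧ ∃ l ∈ N.S.halfPlane, ∃ z : N.S.Interp N.b,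
    N.S.interpVal N.b z = x - N.S.extRes N.b l (N.B u) ∧ y = N.C z + N.G l u

/-- Generalised solutions `(u, x, y)` in the distributional sense. In the third part, `F t` is
`(C&D) ∫_0^t (t - s) (x(s), u(s)) ds`, where the integral of the state is taken in `X₋₁`. -/
structure IsGeneralisedSolution (u : ℝ → U) (x : ℝ → N.S.Extrap N.b)
    (y : VectorDistribution Y) : Prop where
  locInt : MemL1Loc u
  contOn : ContinuousOn x (Set.Ici 0)
  mild : ∃ x₀ : X, ∀ t : ℝ, 0 ≤ t →
    x t = (N.S.extSemigroup N.b).op t.toNNReal (N.S.incl N.b x₀) + N.S.inputMap N.b N.B t u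
  output : ∃ F : ℝ → Y,
    (∀ t : ℝ, 0 ≤ t → ∃ w : X,
      N.S.incl N.b w = ∫ s in (0 : ℝ)..t, (t - s) • x s ∧
        N.IsValueCD w (∫ s in (0 : ℝ)..t, (t - s) • u s) (F t)) ∧
    ∀ φ : testFunctions Y,
      y φ = ∫ t in Set.Ici (0 : ℝ),
        iteratedDerivWithin 2 (φ : ℝ → StrongDual ℂ Y) (Set.Ici 0) t (F t)

/-- `L^∞`-BIBO stability. -/
def LinftyBIBOStable : Prop :=
  ∃ c : ℝ, 0 < c ∧ ∀ (u : ℝ → U) (x : ℝ → N.S.Extrap N.b) (y : VectorDistribution Y),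
    N.IsGeneralisedSolution u x y → MemLinftyLoc u → x 0 = 0 →
      ∃ f : ℝ → Y, MemLinftyLoc f ∧ y.IsRepresentedBy f ∧
        ∀ t : ℝ, 0 < t →
          eLpNorm f ∞ (volume.restrict (Set.Icc 0 t)) ≤
            ENNReal.ofReal c * eLpNorm u ∞ (volume.restrict (Set.Icc 0 t))

end SystemNode

end

/-! Since the output operator is the inclusion, the transfer identity says that `G l - R(l) B` does
not depend on `l`. Call this bounded operator `D`; then `C&D` is simply `(x, u) ↦ x + D u`, so the
output should be the function `x + D u`. With zero initial state, `x(t) = Φ_t u`, and admissibility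
bounds it in `X` by `K ‖u‖` on `[0, t]`, which gives stability with constant `K + ‖D‖`. Two points
need care. The trajectory is continuous only in `X₋₁`, so its measurability in `X` is recovered by
`aestronglyMeasurable_of_incl`. The output is a distribution, and
`integral_iteratedDerivWithin_two_apply` identifies it by Fubini and Taylor's formula. For the
second claim, Hölder on a finite interval turns `L^p` into `L^∞`, and one time `τ` with `‖T(τ)‖ < 1`
makes the bounds uniform in time through `Φ_t u = T(τ) Φ_{t-τ} u + Φ_τ u(· + t - τ)`. -/

namespace C0Semigroup

/-! ### Bounds and joint continuity of a semigroup. -/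

variable {X : Type*} [NormedAddCommGroup X] [NormedSpace ℂ X] (S : C0Semigroup X)

/-- Otherwise some `t n → 0` would have `‖T(t n)‖ > n`, although every orbit `T(t n) x` converges
and is thus bounded; this contradicts Banach–Steinhaus. -/
theorem exists_norm_op_le_near_zero [CompleteSpace X] :
    ∃ δ : ℝ≥0, 0 < δ ∧ ∃ M : ℝ, ∀ t ≤ δ, ‖S.op t‖ ≤ M := by
  by_contra! h
  have hpos : ∀ n : ℕ, (0 : ℝ≥0) < 1 / ((n : ℝ≥0) + 1) := fun n => by positivity
  choose t ht hn using fun n : ℕ => h (1 / ((n : ℝ≥0) + 1)) (hpos n) n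
  have ht0 : Tendsto t atTop (𝓝 0) :=
    tendsto_of_tendsto_of_tendsto_of_le_of_le tendsto_const_nhds
      (tendsto_one_div_add_atTop_nhds_zero_nat (𝕜 := ℝ≥0)) (fun _ => zero_le) ht
  obtain ⟨C, hC⟩ := banach_steinhaus (g := fun n => S.op (t n)) fun x => by
    obtain ⟨c, hc⟩ := ((S.tendsto_op x).comp ht0).norm.bddAbove_range
    exact ⟨c, fun n => hc ⟨n, rfl⟩⟩
  obtain ⟨n, hn'⟩ := exists_nat_gt C
  linarith [hC n, hn n]

theorem exists_norm_op_le [CompleteSpace X] (T : ℝ≥0) : ∃ M : ℝ, ∀ t ≤ T, ‖S.op t‖ ≤ M := by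
  obtain ⟨δ, hδ, M, hM⟩ := S.exists_norm_op_le_near_zero
  have key : ∀ n : ℕ, ∃ M : ℝ, ∀ t ≤ n • δ, ‖S.op t‖ ≤ M := by
    intro n
    induction n with
    | zero => exact ⟨M, fun t ht => hM t (by simp at ht; simp [ht])⟩
    | succ n ih =>
      obtain ⟨M', hM'⟩ := ih
      refine ⟨max M' (M' * M), fun t ht => ?_⟩
      rcases le_total t (n • δ) with h | h
      · exact (hM' t h).trans (le_max_left _ _)
      · have h1 : t - n • δ ≤ δ := by
          rw [tsub_le_iff_left]
          simpa [add_mul] using ht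
        rw [← add_tsub_cancel_of_le h, S.op_add]
        refine ((ContinuousLinearMap.opNorm_comp_le _ _).trans ?_).trans (le_max_right _ _)
        have := (norm_nonneg _).trans (hM' _ le_rfl)
        gcongr
        exacts [hM' _ le_rfl, hM _ h1]
  obtain ⟨n, hn⟩ := Archimedean.arch T hδ
  obtain ⟨M', hM'⟩ := key n
  exact ⟨M', fun t ht => hM' t (ht.trans hn)⟩

/-- A strongly continuous semigroup acts jointly continuously. -/
theorem continuous_op_apply [CompleteSpace X] :
    Continuous fun p : ℝ≥0 × X => S.op p.1 p.2 := by
  rw [continuous_iff_continuousAt]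
  rintro ⟨t, x⟩
  obtain ⟨M, hM⟩ := S.exists_norm_op_le (t + 1)
  have hM0 : 0 ≤ M := (norm_nonneg _).trans (hM 0 zero_le)
  have hd : Tendsto (fun p : ℝ≥0 × X => max p.1 t - min p.1 t) (𝓝 (t, x)) (𝓝 0) := by
    have : Continuous fun p : ℝ≥0 × X => max p.1 t - min p.1 t := by fun_prop
    simpa using this.tendsto (t, x)
  have hb : Tendsto (fun p : ℝ≥0 × X =>
      M * ‖p.2 - x‖ + M * ‖S.op (max p.1 t - min p.1 t) x - x‖) (𝓝 (t, x)) (𝓝 0) := by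
    have h1 : Tendsto (fun p : ℝ≥0 × X => ‖p.2 - x‖) (𝓝 (t, x)) (𝓝 0) := by
      have : Continuous fun p : ℝ≥0 × X => ‖p.2 - x‖ := by fun_prop
      simpa using this.tendsto (t, x)
    have h2 := tendsto_iff_norm_sub_tendsto_zero.1 ((S.tendsto_op x).comp hd)
    simpa using (h1.const_mul M).add (h2.const_mul M)
  rw [ContinuousAt, tendsto_iff_norm_sub_tendsto_zero]
  refine squeeze_zero' (Eventually.of_forall fun _ => norm_nonneg _) ?_ hb
  have hs : ∀ᶠ p : ℝ≥0 × X in 𝓝 (t, x), p.1 < t + 1 :=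
    continuous_fst.continuousAt.eventually_lt_const (lt_add_one t)
  filter_upwards [hs] with p hp
  -- Factoring out `T` at the smaller of the two times treats approach from the left and from the
  -- right at once.
  have h3 : ‖S.op p.1 x - S.op t x‖ ≤ M * ‖S.op (max p.1 t - min p.1 t) x - x‖ := by
    have h4 : ‖S.op (max p.1 t) x - S.op (min p.1 t) x‖
        ≤ M * ‖S.op (max p.1 t - min p.1 t) x - x‖ := by
      have h5 : S.op (max p.1 t) x = S.op (min p.1 t) (S.op (max p.1 t - min p.1 t) x) := by
        rw [← ContinuousLinearMap.comp_apply, ← S.op_add, add_tsub_cancel_of_le min_le_max]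
      rw [h5, ← map_sub]
      refine ((S.op _).le_opNorm _).trans ?_
      gcongr
      exact hM _ ((min_le_right _ _).trans le_self_add)
    rcases le_total p.1 t with h | h
    · rw [max_eq_right h, min_eq_left h, norm_sub_rev] at h4
      rwa [max_eq_right h, min_eq_left h]
    · rw [max_eq_left h, min_eq_right h] at h4
      rwa [max_eq_left h, min_eq_right h]
  calc ‖S.op p.1 p.2 - S.op t x‖
      = ‖S.op p.1 (p.2 - x) + (S.op p.1 x - S.op t x)‖ := by rw [map_sub]; congr 1; abel
    _ ≤ ‖S.op p.1 (p.2 - x)‖ + ‖S.op p.1 x - S.op t x‖ := norm_add_le _ _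
    _ ≤ _ := by
      gcongr
      refine ((S.op _).le_opNorm _).trans ?_
      gcongr
      exact hM _ hp.le

/-- Strong continuity alone does not make `t ↦ T(t)` norm measurable; joint continuity on pairs is
what makes the convolution integrand measurable. -/
theorem aestronglyMeasurable_op_sub [CompleteSpace X] (t : ℝ) {v : ℝ → X} {μ : Measure ℝ}
    (hv : AEStronglyMeasurable v μ) :
    AEStronglyMeasurable (fun s => S.op (t - s).toNNReal (v s)) μ := by
  have h1 : AEStronglyMeasurable (fun s : ℝ => (t - s).toNNReal) μ :=
    Continuous.aestronglyMeasurable (by fun_prop)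
  exact S.continuous_op_apply.comp_aestronglyMeasurable (h1.prodMk hv)

/-- A negative exponent `w` is admitted in the growth bound, so `‖T(t)‖ ≤ M e^{wt} → 0`. -/
theorem ExponentiallyStable.exists_norm_op_lt_one {S : C0Semigroup X}
    (h : S.ExponentiallyStable) : ∃ t : ℝ≥0, 0 < t ∧ ‖S.op t‖ < 1 := by
  obtain ⟨_, ⟨w, ⟨M, hM⟩, rfl⟩, hw⟩ := sInf_lt_iff.1 h
  replace hw : w < 0 := by
    dsimp only at hw
    exact_mod_cast hw
  have h1 : Tendsto (fun t : ℝ => M * Real.exp (t * w)) atTop (𝓝 0) := by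
    simpa using (Real.tendsto_exp_atBot.comp (tendsto_id.atTop_mul_const_of_neg hw)).const_mul M
  obtain ⟨t, ht, ht0⟩ := ((h1.eventually_lt_const one_pos).and (eventually_gt_atTop 0)).exists
  lift t to ℝ≥0 using ht0.le
  refine ⟨t, by exact_mod_cast ht0, lt_of_le_of_lt ?_ ht⟩
  have h2 : Real.exp (-(t : ℝ) * w) * ‖S.op t‖ ≤ M := hM ⟨t, by exact_mod_cast ht0, rfl⟩
  calc ‖S.op t‖ = Real.exp (-(t : ℝ) * w) * ‖S.op t‖ * Real.exp (t * w) := by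
        rw [mul_right_comm, ← Real.exp_add]; simp
    _ ≤ M * Real.exp (t * w) := by gcongr

/-! ### The embedding of `X` into `X₋₁`. -/

variable (b : S.resolventSet)

/-- The embedding `X → X₋₁` as a bounded operator. -/
noncomputable def inclL : X →L[ℂ] S.Extrap b :=
  (S.incl b).mkContinuous ‖S.res b‖ fun x => by
    rw [norm_incl]
    exact (S.res b).le_opNorm x

theorem inclL_apply (x : X) : S.inclL b x = S.incl b x := rfl

theorem incl_injective : Function.Injective (S.incl b) :=
  (injective_iff_map_eq_zero _).2 fun x hx => by
    rw [← norm_eq_zero, norm_incl, norm_eq_zero] at hx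
    exact S.res_injective b.2 (by rw [hx, map_zero])

variable [CompleteSpace X]

/-- A function with values in `X` is strongly measurable if it is so as a function with values in
`X₋₁`: it is the pointwise limit of `(b - h⁻¹ (T(h) - 1)) (b - A)⁻¹ x` as `h → 0`. -/
theorem aestronglyMeasurable_of_incl {α : Type*} [MeasurableSpace α] {μ : Measure α}
    {x : α → S.Extrap b} (hx : AEStronglyMeasurable x μ) {ξ : α → X}
    (h : ∀ᵐ a ∂μ, S.incl b (ξ a) = x a) : AEStronglyMeasurable ξ μ := by
  let h' : ℕ → ℝ≥0 := fun n => 1 / ((n : ℝ≥0) + 1)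
  have hh : Tendsto h' atTop (𝓝[>] 0) :=
    tendsto_nhdsWithin_iff.2 ⟨tendsto_one_div_add_atTop_nhds_zero_nat (𝕜 := ℝ≥0),
      Eventually.of_forall fun n => by simp only [h', Set.mem_Ioi]; positivity⟩
  refine aestronglyMeasurable_of_tendsto_ae atTop (f := fun n a => (b : ℂ) • S.extRes b b (x a) -
    (h' n : ℝ)⁻¹ • (S.op (h' n) (S.extRes b b (x a)) - S.extRes b b (x a))) (fun n => ?_) ?_
  · have : Continuous fun z : S.Extrap b => (b : ℂ) • S.extRes b b z -
        (h' n : ℝ)⁻¹ • (S.op (h' n) (S.extRes b b z) - S.extRes b b z) := by fun_prop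
    exact this.comp_aestronglyMeasurable hx
  · filter_upwards [h] with a ha
    rw [← ha, extRes_incl]
    obtain ⟨hm, hr⟩ := (S.res_spec b.2).1 (ξ a)
    have hg := (S.generator_spec ⟨_, hm⟩).comp hh
    have := (tendsto_const_nhds (x := (b : ℂ) • S.res b (ξ a))).sub hg
    rwa [hr] at this

/-! ### Input maps and their admissibility bounds. -/

section Input

variable {U : Type*} [NormedAddCommGroup U] [NormedSpace ℂ U] (B : U →L[ℂ] S.Extrap b)

theorem integrableOn_inputMap_integrand {t : ℝ} {u : ℝ → U}
    (hu : IntegrableOn u (Set.Ioc 0 t)) :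
    IntegrableOn (fun s => (S.extSemigroup b).op (t - s).toNNReal (B (u s))) (Set.Ioc 0 t) := by
  obtain ⟨M, hM⟩ := (S.extSemigroup b).exists_norm_op_le t.toNNReal
  refine Integrable.mono' (g := fun s => M * (‖B‖ * ‖u s‖))
    ((hu.norm.const_mul _).const_mul _)
    ((S.extSemigroup b).aestronglyMeasurable_op_sub t
      (B.continuous.comp_aestronglyMeasurable hu.aestronglyMeasurable)) ?_
  filter_upwards [ae_restrict_mem measurableSet_Ioc] with s hs
  have hm : ‖(S.extSemigroup b).op (t - s).toNNReal‖ ≤ M :=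
    hM _ (Real.toNNReal_le_toNNReal (by linarith [hs.1]))
  have := (norm_nonneg _).trans hm
  refine (ContinuousLinearMap.le_opNorm _ _).trans ?_
  gcongr
  exact B.le_opNorm _

theorem inputMap_congr {t : ℝ} (ht : 0 ≤ t) {u v : ℝ → U} (h : ∀ s ∈ Set.Ioc 0 t, u s = v s) :
    S.inputMap b B t u = S.inputMap b B t v := by
  unfold inputMap
  refine intervalIntegral.integral_congr_ae (Eventually.of_forall fun s hs => ?_)
  rw [Set.uIoc_of_le ht] at hs
  rw [h s hs]

/-- Time invariance: delaying the input by `τ - t`, with zero before, reaches at time `τ` the state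
otherwise reached at `t`. A bound at `τ` thus serves all earlier times. -/
theorem inputMap_shift {t τ : ℝ} (ht : 0 ≤ t) (h : t ≤ τ) (u : ℝ → U) :
    S.inputMap b B τ ((Set.Ioi (τ - t)).indicator fun s => u (s - (τ - t))) =
      S.inputMap b B t u := by
  have h1 : (fun s => (S.extSemigroup b).op (τ - s).toNNReal
      (B ((Set.Ioi (τ - t)).indicator (fun s => u (s - (τ - t))) s))) =
      (Set.Ioi (τ - t)).indicator (fun s => (S.extSemigroup b).op (t - (s - (τ - t))).toNNReal
        (B (u (s - (τ - t))))) := by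
    ext1 s
    by_cases hs : s ∈ Set.Ioi (τ - t)
    · rw [Set.indicator_of_mem hs, Set.indicator_of_mem hs]
      congr 3
      ring
    · rw [Set.indicator_of_notMem hs, Set.indicator_of_notMem hs, map_zero, map_zero]
  unfold inputMap
  rw [h1, intervalIntegral.integral_of_le (ht.trans h), setIntegral_indicator measurableSet_Ioi]
  have h2 : Set.Ioc 0 τ ∩ Set.Ioi (τ - t) = Set.Ioc (τ - t) τ := by
    ext s
    simp only [Set.mem_inter_iff, Set.mem_Ioc, Set.mem_Ioi]
    constructor
    · rintro ⟨⟨_, h2⟩, h3⟩; exact ⟨h3, h2⟩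
    · rintro ⟨h1, h2⟩; exact ⟨⟨by linarith, h2⟩, h1⟩
  rw [h2, ← intervalIntegral.integral_of_le (by linarith),
    intervalIntegral.integral_comp_sub_right
      (fun s => (S.extSemigroup b).op (t - s).toNNReal (B (u s)))]
  simp

/-- Split the integral at time `t`; by the semigroup law `T₋₁(τ)` factors out of the first piece,
and translation turns the second into an input map of length `τ`. -/
theorem inputMap_add {t τ : ℝ} (ht : 0 ≤ t) (hτ : 0 ≤ τ) {u : ℝ → U}
    (hu : IntegrableOn u (Set.Ioc 0 (t + τ))) :
    S.inputMap b B (t + τ) u = (S.extSemigroup b).op τ.toNNReal (S.inputMap b B t u) +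
      S.inputMap b B τ (fun s => u (s + t)) := by
  have hi := S.integrableOn_inputMap_integrand b B hu
  have hi1 := hi.mono_set (Set.Ioc_subset_Ioc_right (by linarith : t ≤ t + τ))
  have hi2 := hi.mono_set (Set.Ioc_subset_Ioc_left ht)
  have hu1 := S.integrableOn_inputMap_integrand b B
    (hu.mono_set (Set.Ioc_subset_Ioc_right (by linarith : t ≤ t + τ)))
  unfold inputMap
  rw [← intervalIntegral.integral_add_adjacent_intervals (b := t)
    ((intervalIntegrable_iff_integrableOn_Ioc_of_le ht).2 hi1)
    ((intervalIntegrable_iff_integrableOn_Ioc_of_le (by linarith)).2 hi2)]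
  congr 1
  · rw [intervalIntegral.integral_of_le ht, intervalIntegral.integral_of_le ht,
      ← ContinuousLinearMap.integral_comp_comm _ hu1]
    refine setIntegral_congr_fun measurableSet_Ioc fun s hs => ?_
    rw [show t + τ - s = τ + (t - s) by ring, Real.toNNReal_add hτ (by linarith [hs.2]),
      (S.extSemigroup b).op_add]
    rfl
  · have := intervalIntegral.integral_comp_add_right (a := 0) (b := τ)
      (fun s => (S.extSemigroup b).op (t + τ - s).toNNReal (B (u s))) t
    rw [zero_add, add_comm τ t] at this
    rw [← this]
    congr 1
    ext1 s
    congr 3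
    ring

variable {S b B}

/-- The bound on `Φ_t u` only involves `u` on `[0, t]`. -/
theorem InputMapBound.exists_le {p : ℝ≥0∞} {t K : ℝ} (h : S.InputMapBound b B p t K)
    (ht : 0 ≤ t) {u : ℝ → U} (hu : MemLp u p (volume.restrict (Set.Icc 0 t))) :
    ∃ x : X, S.incl b x = S.inputMap b B t u ∧
      ‖x‖ ≤ K * (eLpNorm u p (volume.restrict (Set.Icc 0 t))).toReal := by
  have hr : (volume.restrict (Set.Ici (0 : ℝ))).restrict (Set.Icc 0 t) =
      volume.restrict (Set.Icc 0 t) := by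
    rw [Measure.restrict_restrict measurableSet_Icc,
      Set.inter_eq_left.2 Set.Icc_subset_Ici_self]
  obtain ⟨x, hx, hn⟩ := h ((Set.Icc 0 t).indicator u)
    ((memLp_indicator_iff_restrict measurableSet_Icc).2 (by rwa [hr]))
  rw [eLpNorm_indicator_eq_eLpNorm_restrict measurableSet_Icc, hr] at hn
  refine ⟨x, hx.trans (S.inputMap_congr b B ht fun s hs => ?_), hn⟩
  exact Set.indicator_of_mem (Set.Ioc_subset_Icc_self hs) u

/-- On a finite time interval, `L^p`-admissibility implies `L^∞`-admissibility. -/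
theorem InputMapBound.top {p : ℝ≥0∞} {t K : ℝ} (ht : 0 ≤ t)
    (h : S.InputMapBound b B p t K) : ∃ K' : ℝ, 0 ≤ K' ∧ S.InputMapBound b B ∞ t K' := by
  -- The Hölder constant. As `(∞ : ℝ≥0∞).toReal = 0`, the second fraction is `0`, and so is the
  -- first when `p = ∞`. The absolute value is there because `K` may have any sign.
  refine ⟨|K| * (volume.restrict (Set.Icc 0 t) Set.univ ^
    (1 / p.toReal - 1 / (∞ : ℝ≥0∞).toReal)).toReal, by positivity, fun u hu => ?_⟩
  have hu' : MemLp u ∞ (volume.restrict (Set.Icc 0 t)) :=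
    hu.mono_measure (Measure.restrict_mono Set.Icc_subset_Ici_self le_rfl)
  obtain ⟨x, hx, hn⟩ := h.exists_le ht (hu'.mono_exponent (p := p) le_top)
  refine ⟨x, hx, hn.trans ?_⟩
  have h1 := eLpNorm_le_eLpNorm_mul_rpow_measure_univ (p := p) (q := ∞)
    (μ := volume.restrict (Set.Icc 0 t)) le_top hu'.1
  have h2 : eLpNorm u ∞ (volume.restrict (Set.Icc 0 t)) ≤
      eLpNorm u ∞ (volume.restrict (Set.Ici 0)) :=
    eLpNorm_mono_measure _ (Measure.restrict_mono Set.Icc_subset_Ici_self le_rfl)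
  have hfin : (volume.restrict (Set.Icc 0 t) Set.univ) ^
      (1 / p.toReal - 1 / (∞ : ℝ≥0∞).toReal) ≠ (∞ : ℝ≥0∞) :=
    ENNReal.rpow_ne_top_of_nonneg (by simp) (by simp)
  rw [mul_assoc, mul_comm _ (eLpNorm u ∞ _).toReal, ← ENNReal.toReal_mul]
  refine mul_le_mul (le_abs_self K) (ENNReal.toReal_mono
    (ENNReal.mul_ne_top hu.2.ne hfin) (h1.trans ?_)) ENNReal.toReal_nonneg (abs_nonneg K)
  gcongr

/-- With `q = ‖T(τ)‖ < 1` and a bound `K` for `Φ_τ`, a bound `M` at time `t - τ` becomes `q M + K`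
at time `t`. The choice `M = K / (1 - q)` is the fixed point of this recursion, so it survives an
induction over blocks of length `τ`. -/
theorem ControlAdmissible.infiniteTime_of_exponentiallyStable {p : ℝ≥0∞}
    (h : S.ControlAdmissible b B p) (hS : S.ExponentiallyStable) :
    S.InfiniteTimeControlAdmissible b B ∞ := by
  obtain ⟨τ, hτ, hq⟩ := hS.exists_norm_op_lt_one
  have hτ' : (0 : ℝ) < τ := by exact_mod_cast hτ
  obtain ⟨K₀, hK₀⟩ := h τ hτ'
  obtain ⟨K, hK0, hK⟩ := hK₀.top hτ'.le
  have hq' : 0 < 1 - ‖S.op τ‖ := sub_pos.2 hq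
  have hKM : K ≤ K / (1 - ‖S.op τ‖) := by
    rw [le_div_iff₀ hq']
    nlinarith [norm_nonneg (S.op τ)]
  have hM : ‖S.op τ‖ * (K / (1 - ‖S.op τ‖)) + K = K / (1 - ‖S.op τ‖) := by
    field_simp
    ring
  have key : ∀ n : ℕ, ∀ t : ℝ, 0 < t → t ≤ (n + 1) * τ →
      S.InputMapBound b B ∞ t (K / (1 - ‖S.op τ‖)) := by
    intro n
    induction n with
    | zero =>
      intro t ht htτ u hu
      have htτ : t ≤ τ := by simpa using htτ
      have hmp : MeasurePreserving (fun s : ℝ => s - (τ - t))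
          (volume.restrict (Set.Ici ((τ : ℝ) - t))) (volume.restrict (Set.Ici 0)) := by
        have := (measurePreserving_sub_right volume ((τ : ℝ) - t)).restrict_preimage
          (measurableSet_Ici (a := (0 : ℝ)))
        simpa using this
      have hr : (volume.restrict (Set.Ici (0 : ℝ))).restrict (Set.Ioi ((τ : ℝ) - t)) =
          volume.restrict (Set.Ici ((τ : ℝ) - t)) := by
        rw [Measure.restrict_restrict measurableSet_Ioi, Set.inter_eq_left.2
          (Set.Ioi_subset_Ici (sub_nonneg.2 htτ)), restrict_Ioi_eq_restrict_Ici]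
      -- For `t ≤ τ` the delayed input has the same norm, so the bound at `τ` applies.
      obtain ⟨x, hx, hn⟩ := hK ((Set.Ioi ((τ : ℝ) - t)).indicator fun s => u (s - (τ - t)))
        ((memLp_indicator_iff_restrict measurableSet_Ioi).2
          (by rw [hr]; exact hu.comp_measurePreserving hmp))
      rw [S.inputMap_shift b B ht.le htτ] at hx
      have hne := eLpNorm_comp_measurePreserving (p := ∞) hu.1 hmp
      rw [Function.comp_def] at hne
      rw [eLpNorm_indicator_eq_eLpNorm_restrict measurableSet_Ioi, hr, hne] at hn
      exact ⟨x, hx, hn.trans (by gcongr)⟩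
    | succ n ih =>
      intro t ht htn u hu
      push_cast at htn
      rcases le_or_gt t τ with htτ | htτ
      · exact ih t ht (by nlinarith [n.cast_nonneg (α := ℝ)]) u hu
      obtain ⟨x, hx, hxn⟩ := ih (t - τ) (by linarith) (by linarith) u hu
      have hmp : MeasurePreserving (fun s : ℝ => s + (t - τ))
          (volume.restrict (Set.Ici 0)) (volume.restrict (Set.Ici (t - τ))) := by
        have := (measurePreserving_add_right volume (t - (τ : ℝ))).restrict_preimage
          (measurableSet_Ici (a := (t - τ : ℝ)))
        simpa using this
      have hle : volume.restrict (Set.Ici (t - τ)) ≤ volume.restrict (Set.Ici (0 : ℝ)) :=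
        Measure.restrict_mono (Set.Ici_subset_Ici.2 (by linarith)) le_rfl
      have hu' := hu.mono_measure hle
      obtain ⟨y, hy, hyn⟩ := hK (fun s => u (s + (t - τ))) (hu'.comp_measurePreserving hmp)
      have hne := eLpNorm_comp_measurePreserving (p := ∞) hu'.1 hmp
      rw [Function.comp_def] at hne
      rw [hne] at hyn
      have hyn' : ‖y‖ ≤ K * (eLpNorm u ∞ (volume.restrict (Set.Ici 0))).toReal := by
        refine hyn.trans ?_
        gcongr
        exact hu.2.ne
      refine ⟨S.op τ x + y, ?_, ?_⟩
      · have hint : IntegrableOn u (Set.Ioc 0 (t - τ + τ)) :=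
          ((hu.mono_measure (Measure.restrict_mono
            (Set.Ioc_subset_Icc_self.trans Set.Icc_subset_Ici_self) le_rfl)).mono_exponent
            le_top).integrable le_rfl
        have hadd := S.inputMap_add b B (t := t - τ) (by linarith) hτ'.le hint
        rw [sub_add_cancel] at hadd
        rw [hadd, ← hx, ← hy, map_add, Real.toNNReal_coe]
        congr 1
        exact (S.extOp_incl b τ x).symm
      · refine (norm_add_le _ _).trans ?_
        rw [← hM, add_mul, mul_assoc]
        exact add_le_add (((S.op τ).le_opNorm x).trans (by gcongr)) hyn'
  refine ⟨K / (1 - ‖S.op τ‖), fun t ht => ?_⟩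
  obtain ⟨n, hn⟩ := exists_nat_gt (t / τ)
  refine key n t ht ?_
  rw [div_lt_iff₀ hτ'] at hn
  nlinarith

end Input

end C0Semigroup

/-! ### Taylor's formula for test functions. -/

section Taylor

variable {E : Type*} [NormedAddCommGroup E] [NormedSpace ℝ E]

theorem iteratedDerivWithin_Ici_eq_zero {φ : ℝ → E} {r : ℝ} (hr : ∀ t > r, φ t = 0) (n : ℕ)
    {t : ℝ} (ht : r < t) : iteratedDerivWithin n φ (Set.Ici 0) t = 0 := by
  induction n generalizing t with
  | zero => simpa using hr t ht
  | succ n ih =>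
    have h : iteratedDerivWithin n φ (Set.Ici 0) =ᶠ[𝓝 t] fun _ => 0 := by
      filter_upwards [Ioi_mem_nhds ht] with s hs using ih hs
    rw [iteratedDerivWithin_succ, (h.filter_mono nhdsWithin_le_nhds).derivWithin_eq (ih ht)]
    simp

/-- Taylor's formula with integral remainder, for a function that vanishes near the right end. -/
theorem integral_sub_smul_iteratedDerivWithin_two [CompleteSpace E] {φ : ℝ → E}
    (hφ : ContDiffOn ℝ ∞ φ (Set.Ici 0)) {r : ℝ} (hr : ∀ t > r, φ t = 0) {s R : ℝ} (hs : 0 ≤ s)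
    (hsR : s ≤ R) (hrR : r < R) :
    ∫ t in s..R, (t - s) • iteratedDerivWithin 2 φ (Set.Ici 0) t = φ s := by
  have hd : ∀ n : ℕ, ∀ t : ℝ, 0 < t → HasDerivAt (iteratedDerivWithin n φ (Set.Ici 0))
      (iteratedDerivWithin (n + 1) φ (Set.Ici 0) t) t := by
    intro n t ht
    have h1 := ((hφ.differentiableOn_iteratedDerivWithin (m := n)
      (by exact_mod_cast ENat.natCast_lt_top n) (uniqueDiffOn_Ici 0)) t ht.le).hasDerivWithinAt
    rw [← iteratedDerivWithin_succ] at h1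
    exact h1.hasDerivAt (Ici_mem_nhds ht)
  have hc : ∀ n : ℕ, ContinuousOn (iteratedDerivWithin n φ (Set.Ici 0)) (Set.Icc s R) := fun n =>
    (hφ.continuousOn_iteratedDerivWithin (by exact_mod_cast le_top) (uniqueDiffOn_Ici 0)).mono
      fun t ht => hs.trans ht.1
  have h0 := hc 0
  have h1 := hc 1
  have h2 := hc 2
  have h3 : ContinuousOn (fun t => (t - s) • iteratedDerivWithin 2 φ (Set.Ici 0) t)
      (Set.Icc s R) := by fun_prop
  -- The antiderivative `(t - s) φ' - φ` vanishes at `R` and equals `-φ s` at `s`. Two-sided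
  -- derivatives are needed only in the open interval, so `s = 0` is allowed.
  rw [intervalIntegral.integral_eq_sub_of_hasDerivAt_of_le hsR
    (f := fun t => (t - s) • iteratedDerivWithin 1 φ (Set.Ici 0) t -
      iteratedDerivWithin 0 φ (Set.Ici 0) t) (by fun_prop) (fun t ht => ?_)
    (h3.intervalIntegrable_of_Icc hsR)]
  · simp [iteratedDerivWithin_Ici_eq_zero hr 1 hrR, hr R hrR]
  · have ht0 : 0 < t := hs.trans_lt ht.1
    have := (((hasDerivAt_id t).sub_const s).smul (hd 1 t ht0)).sub (hd 0 t ht0)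
    rw [one_smul, add_sub_cancel_right] at this
    exact this

end Taylor

/-! ### The second distributional derivative. -/

section Duality

variable {X : Type*} [NormedAddCommGroup X] [NormedSpace ℂ X]

/-- Writing the kernel as the positive part of `t - s` moves the double integral from a triangle to
a fixed square, where Fubini applies; `integral_max_sub_smul'` does this for the other variable. -/
theorem integral_max_sub_smul {f : ℝ → X} {t R : ℝ} (ht : 0 ≤ t) (htR : t ≤ R) :
    ∫ s in Set.Ioc 0 R, max (t - s) 0 • f s = ∫ s in (0 : ℝ)..t, (t - s) • f s := by
  rw [intervalIntegral.integral_of_le ht, ← integral_indicator measurableSet_Ioc,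
    ← integral_indicator measurableSet_Ioc]
  congr 1
  ext1 s
  by_cases h1 : s ∈ Set.Ioc 0 t
  · rw [Set.indicator_of_mem h1, Set.indicator_of_mem (Set.Ioc_subset_Ioc_right htR h1),
      max_eq_left (sub_nonneg.2 h1.2)]
  · rw [Set.indicator_of_notMem h1]
    by_cases h2 : s ∈ Set.Ioc 0 R
    · rw [Set.indicator_of_mem h2, max_eq_right, zero_smul]
      rw [sub_nonpos]
      by_contra! h
      exact h1 ⟨h2.1, h.le⟩
    · rw [Set.indicator_of_notMem h2]

theorem integral_max_sub_smul' {E : Type*} [NormedAddCommGroup E] [NormedSpace ℝ E]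
    {g : ℝ → E} {s R : ℝ} (hs : 0 ≤ s) (hsR : s ≤ R) :
    ∫ t in Set.Ioc 0 R, max (t - s) 0 • g t = ∫ t in s..R, (t - s) • g t := by
  rw [intervalIntegral.integral_of_le hsR, ← integral_indicator measurableSet_Ioc,
    ← integral_indicator measurableSet_Ioc]
  congr 1
  ext1 t
  by_cases h1 : t ∈ Set.Ioc s R
  · rw [Set.indicator_of_mem h1, Set.indicator_of_mem (Set.Ioc_subset_Ioc_left hs h1),
      max_eq_left (sub_nonneg.2 h1.1.le)]
  · rw [Set.indicator_of_notMem h1]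
    by_cases h2 : t ∈ Set.Ioc 0 R
    · rw [Set.indicator_of_mem h2, max_eq_right, zero_smul]
      rw [sub_nonpos]
      by_contra! h
      exact h1 ⟨h, h2.2⟩
    · rw [Set.indicator_of_notMem h2]

theorem setIntegral_Ici_eq_Ioc {E : Type*} [NormedAddCommGroup E] [NormedSpace ℝ E]
    {g : ℝ → E} {R : ℝ} (h : ∀ t > R, g t = 0) :
    ∫ t in Set.Ici 0, g t = ∫ t in Set.Ioc 0 R, g t := by
  rw [integral_Ici_eq_integral_Ioi]
  refine setIntegral_eq_of_subset_of_forall_sdiff_eq_zero measurableSet_Ioi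
    Set.Ioc_subset_Ioi_self fun t ht => h t ?_
  by_contra! hle
  exact ht.2 ⟨ht.1, hle⟩

/-- The second distributional derivative of `t ↦ ∫_0^t (t - s) f(s) ds` is `f`. -/
theorem integral_iteratedDerivWithin_two_apply [CompleteSpace X] {f : ℝ → X}
    (hf : ∀ R, IntegrableOn f (Set.Ioc 0 R)) (φ : testFunctions X) :
    ∫ t in Set.Ici (0 : ℝ), iteratedDerivWithin 2 (φ : ℝ → StrongDual ℂ X) (Set.Ici 0) t
        (∫ s in (0 : ℝ)..t, (t - s) • f s) =
      ∫ t in Set.Ici (0 : ℝ), (φ : ℝ → StrongDual ℂ X) t (f t) := by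
  obtain ⟨φ, hφ, -, r, hr⟩ := φ
  dsimp only
  set ψ := iteratedDerivWithin 2 φ (Set.Ici 0) with hψ
  -- Strictly beyond `r`, so that `φ` and its derivatives vanish at `R` itself, and positive.
  set R := max r 0 + 1 with hR
  have hrR : r < R := by linarith [le_max_left r 0]
  have hR0 : 0 < R := by linarith [le_max_right r 0]
  rw [setIntegral_Ici_eq_Ioc (R := R) fun t ht => by
      rw [hψ, iteratedDerivWithin_Ici_eq_zero hr 2 (hrR.trans ht)]; rfl,
    setIntegral_Ici_eq_Ioc (R := R) fun t ht => by rw [hr t (hrR.trans ht)]; rfl]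
  have hle : ∀ n : ℕ, (n : ℕ∞ω) ≤ (∞ : ℕ∞ω) := fun n => by exact_mod_cast le_top
  have hψc : ContinuousOn ψ (Set.Ici 0) :=
    hφ.continuousOn_iteratedDerivWithin (hle 2) (uniqueDiffOn_Ici 0)
  obtain ⟨C, hC⟩ := isCompact_Icc.exists_bound_of_continuousOn
    (s := Set.Icc 0 R) (hψc.mono Set.Icc_subset_Ici_self)
  have hker : ∀ t : ℝ, IntegrableOn (fun s => max (t - s) 0 • f s) (Set.Ioc 0 R) := fun t =>
    (hf R).bdd_smul (φ := fun s => max (t - s) 0) (|t| + R)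
      (Continuous.aestronglyMeasurable (by fun_prop)) <| by
      filter_upwards [ae_restrict_mem measurableSet_Ioc] with s hs
      rw [Real.norm_of_nonneg (le_max_right _ _)]
      exact max_le (by linarith [le_abs_self t, hs.1]) (by positivity)
  have hkerψ : ∀ s ∈ Set.Ioc 0 R, IntegrableOn (fun t => max (t - s) 0 • ψ t) (Set.Ioc 0 R) :=
    fun s hs => by
      have : ContinuousOn ψ (Set.Icc 0 R) := hψc.mono Set.Icc_subset_Ici_self
      have h : ContinuousOn (fun t => max (t - s) 0 • ψ t) (Set.Icc 0 R) := by fun_prop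
      exact h.integrableOn_Icc.mono_set Set.Ioc_subset_Icc_self
  have hint : Integrable (Function.uncurry fun t s => ψ t (max (t - s) 0 • f s))
      ((volume.restrict (Set.Ioc 0 R)).prod (volume.restrict (Set.Ioc 0 R))) := by
    refine Integrable.mono' (g := fun p : ℝ × ℝ => C * (R * ‖f p.2‖))
      ((((hf R).norm.const_mul R).const_mul C).comp_snd _) ?_ ?_
    · have h1 : AEStronglyMeasurable (fun p : ℝ × ℝ => ψ p.1)
          ((volume.restrict (Set.Ioc 0 R)).prod (volume.restrict (Set.Ioc 0 R))) :=
        ((hψc.mono (Set.Ioc_subset_Icc_self.trans Set.Icc_subset_Ici_self)).aestronglyMeasurable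
          measurableSet_Ioc).comp_fst
      have h2 : AEStronglyMeasurable (fun p : ℝ × ℝ => max (p.1 - p.2) 0 • f p.2)
          ((volume.restrict (Set.Ioc 0 R)).prod (volume.restrict (Set.Ioc 0 R))) :=
        AEStronglyMeasurable.smul (f := fun p : ℝ × ℝ => max (p.1 - p.2) 0)
          (Continuous.aestronglyMeasurable (by fun_prop))
          (hf R).aestronglyMeasurable.comp_snd
      have h3 : Continuous fun q : StrongDual ℂ X × X => q.1 q.2 := by fun_prop
      exact h3.comp_aestronglyMeasurable (h1.prodMk h2)
    · rw [Measure.prod_restrict]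
      filter_upwards [ae_restrict_mem (measurableSet_Ioc.prod measurableSet_Ioc)] with p hp
      have hψp := hC p.1 ⟨hp.1.1.le, hp.1.2⟩
      have hC0 := (norm_nonneg _).trans hψp
      refine ((ψ p.1).le_opNorm _).trans ?_
      rw [norm_smul, Real.norm_of_nonneg (le_max_right _ _)]
      gcongr
      exact max_le (by linarith [hp.1.2, hp.2.1]) hR0.le
  calc ∫ t in Set.Ioc 0 R, ψ t (∫ s in (0 : ℝ)..t, (t - s) • f s)
      = ∫ t in Set.Ioc 0 R, ∫ s in Set.Ioc 0 R, ψ t (max (t - s) 0 • f s) := by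
        refine setIntegral_congr_fun measurableSet_Ioc fun t ht => ?_
        rw [← integral_max_sub_smul ht.1.le ht.2, ContinuousLinearMap.integral_comp_comm _ (hker t)]
    _ = ∫ s in Set.Ioc 0 R, ∫ t in Set.Ioc 0 R, ψ t (max (t - s) 0 • f s) :=
        integral_integral_swap hint
    -- For fixed `s`, the inner integral is Taylor's formula evaluated at `f s`.
    _ = ∫ s in Set.Ioc 0 R, φ s (f s) := by
        refine setIntegral_congr_fun measurableSet_Ioc fun s hs => ?_
        rw [← integral_sub_smul_iteratedDerivWithin_two hφ hr hs.1.le hs.2 hrR,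
          ← integral_max_sub_smul' hs.1.le hs.2,
          ContinuousLinearMap.integral_apply (hkerψ s hs)]
        refine integral_congr_ae (Eventually.of_forall fun t => ?_)
        simp

end Duality

section LinftyLoc

variable {E : Type*} [NormedAddCommGroup E]

theorem MemLinftyLoc.integrableOn_Ioc {g : ℝ → E} (hg : MemLinftyLoc g) (R : ℝ) :
    IntegrableOn g (Set.Ioc 0 R) :=
  (((hg R).mono_measure (Measure.restrict_mono Set.Ioc_subset_Icc_self le_rfl)).mono_exponent
    le_top).integrable le_rfl

theorem MemLinftyLoc.intervalIntegrable_sub_smul [NormedSpace ℝ E] {g : ℝ → E}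
    (hg : MemLinftyLoc g) {t : ℝ} (ht : 0 ≤ t) :
    IntervalIntegrable (fun s => (t - s) • g s) volume 0 t :=
  ((intervalIntegrable_iff_integrableOn_Ioc_of_le ht).2 (hg.integrableOn_Ioc t)).continuousOn_smul
    (by fun_prop)

end LinftyLoc

/-! ### The state as a function with values in `X`. -/

namespace C0Semigroup

variable {X : Type*} [NormedAddCommGroup X] [NormedSpace ℂ X] [CompleteSpace X]
  {S : C0Semigroup X} {b : S.resolventSet}
  {U : Type*} [NormedAddCommGroup U] [NormedSpace ℂ U] {B : U →L[ℂ] S.Extrap b}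

/-- The state trajectory with zero initial value, as a function with values in `X`. -/
theorem InfiniteTimeControlAdmissible.exists_state (h : S.InfiniteTimeControlAdmissible b B ∞) :
    ∃ K : ℝ, 0 ≤ K ∧ ∀ u : ℝ → U, MemLinftyLoc u →
      ContinuousOn (fun t => S.inputMap b B t u) (Set.Ici 0) →
      ∃ ξ : ℝ → X, (∀ t, 0 ≤ t → S.incl b (ξ t) = S.inputMap b B t u) ∧
        AEStronglyMeasurable ξ (volume.restrict (Set.Ici 0)) ∧
        ∀ s t, 0 ≤ s → s ≤ t →
          ‖ξ s‖ₑ ≤ ENNReal.ofReal K * eLpNorm u ∞ (volume.restrict (Set.Icc 0 t)) := by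
  obtain ⟨K, hK⟩ := h
  refine ⟨|K|, abs_nonneg K, fun u hu hc => ?_⟩
  have hex : ∀ t : ℝ, ∃ x : X, 0 ≤ t → S.incl b x = S.inputMap b B t u ∧
      ‖x‖ₑ ≤ ENNReal.ofReal |K| * eLpNorm u ∞ (volume.restrict (Set.Icc 0 t)) := by
    intro t
    rcases lt_trichotomy t 0 with ht | rfl | ht
    · exact ⟨0, fun h => absurd h ht.not_ge⟩
    -- Admissibility speaks only of positive times; at time `0` the input map vanishes.
    · exact ⟨0, fun _ => ⟨by simp [inputMap], by simp⟩⟩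
    · obtain ⟨x, hx, hn⟩ := (hK t ht).exists_le ht.le (hu t)
      refine ⟨x, fun _ => ⟨hx, ?_⟩⟩
      rw [← ofReal_norm, ← ENNReal.ofReal_toReal (hu t).2.ne, ← ENNReal.ofReal_mul (abs_nonneg K)]
      exact ENNReal.ofReal_le_ofReal (hn.trans (by gcongr; exact le_abs_self K))
  choose ξ hξ using hex
  refine ⟨ξ, fun t ht => (hξ t ht).1, ?_, fun s t hs hst => (hξ s hs).2.trans ?_⟩
  · refine S.aestronglyMeasurable_of_incl b (hc.aestronglyMeasurable measurableSet_Ici) ?_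
    filter_upwards [ae_restrict_mem measurableSet_Ici] with t ht using (hξ t ht).1
  · gcongr

end C0Semigroup

/-! ### The output and stability. -/

namespace SystemNode

variable {U X : Type*} [NormedAddCommGroup U] [NormedSpace ℂ U]
  [NormedAddCommGroup X] [NormedSpace ℂ X] [CompleteSpace X] (N : SystemNode U X X)

/-- For `C = 𝕀` the operator `C&D` is `(x, u) ↦ x + (G(l) - R(l, A) B) u`. -/
theorem IsValueCD.eq_add {N : SystemNode U X X} (hC : ∀ z, N.C z = N.S.interpVal N.b z) {m : ℂ}
    (hm : m ∈ N.S.halfPlane) {x : X} {u : U} {y : X} (h : N.IsValueCD x u y) :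
    y = x + (N.G m - (N.S.extRes N.b m).comp N.B) u := by
  obtain ⟨-, l, hl, z, hz, rfl⟩ := h
  -- With `C` the inclusion, this reads `G l u - G m u = R(l) B u - R(m) B u`, so the feedthrough is
  -- the same at `l` and `m`.
  obtain ⟨z', hz', hG⟩ := N.G_sub l hl m hm u
  rw [hC, hz'] at hG
  rw [hC, hz, sub_add_eq_add_sub, add_sub_assoc, sub_eq_sub_iff_sub_eq_sub.1 hG]
  rfl

theorem linftyBIBOStable_of_infiniteTimeControlAdmissible [CompleteSpace U]
    (hC : ∀ z, N.C z = N.S.interpVal N.b z)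
    (hB : N.S.InfiniteTimeControlAdmissible N.b N.B ∞) : N.LinftyBIBOStable := by
  by_cases hne : ∃ m, m ∈ N.S.halfPlane
  swap
  -- If the half-plane were empty, `C&D` would have no values and there would be no generalised
  -- solutions.
  · refine ⟨1, one_pos, fun u x y h _ _ => ?_⟩
    obtain ⟨F, hF, -⟩ := h.output
    obtain ⟨_, -, -, l, hl, -⟩ := hF 0 le_rfl
    exact absurd ⟨l, hl⟩ hne
  obtain ⟨m, hm⟩ := hne
  obtain ⟨K, hK0, hK⟩ := hB.exists_state
  set D : U →L[ℂ] X := N.G m - (N.S.extRes N.b m).comp N.B with hD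
  -- The summand `1` only makes the constant strictly positive.
  refine ⟨K + ‖D‖ + 1, by positivity, fun u x y h hu hx0 => ?_⟩
  have hx : ∀ t, 0 ≤ t → x t = N.S.inputMap N.b N.B t u := by
    obtain ⟨x₀, hx₀⟩ := h.mild
    have h0 := hx₀ 0 le_rfl
    rw [hx0, Real.toNNReal_zero, (N.S.extSemigroup N.b).op_zero] at h0
    simp only [C0Semigroup.inputMap, intervalIntegral.integral_same, add_zero,
      ContinuousLinearMap.id_apply] at h0
    have hx₀0 : N.S.incl N.b x₀ = 0 := h0.symm
    intro t ht
    rw [hx₀ t ht, hx₀0, map_zero, zero_add]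
  obtain ⟨ξ, hξ, hξm, hξb⟩ := hK u hu (h.contOn.congr fun t ht => (hx t ht).symm)
  have hbound : ∀ t : ℝ,
      eLpNorm (fun s => ξ s + D (u s)) ∞ (volume.restrict (Set.Icc 0 t)) ≤
        ENNReal.ofReal (K + ‖D‖ + 1) * eLpNorm u ∞ (volume.restrict (Set.Icc 0 t)) := by
    intro t
    rw [eLpNorm_exponent_top]
    refine eLpNormEssSup_le_of_ae_enorm_bound ?_
    filter_upwards [ae_restrict_mem measurableSet_Icc,
      enorm_ae_le_eLpNormEssSup u (volume.restrict (Set.Icc 0 t))] with s hs hus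
    rw [← eLpNorm_exponent_top] at hus
    have hDs : ‖D (u s)‖ₑ ≤
        ENNReal.ofReal ‖D‖ * eLpNorm u ∞ (volume.restrict (Set.Icc 0 t)) := by
      rw [ofReal_norm]
      exact (D.le_opENorm _).trans (by gcongr)
    calc ‖ξ s + D (u s)‖ₑ ≤ ‖ξ s‖ₑ + ‖D (u s)‖ₑ := enorm_add_le _ _
      _ ≤ ENNReal.ofReal K * eLpNorm u ∞ (volume.restrict (Set.Icc 0 t)) +
          ENNReal.ofReal ‖D‖ * eLpNorm u ∞ (volume.restrict (Set.Icc 0 t)) :=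
        add_le_add (hξb s t hs.1 hs.2) hDs
      _ = ENNReal.ofReal (K + ‖D‖) * eLpNorm u ∞ (volume.restrict (Set.Icc 0 t)) := by
        rw [← add_mul, ENNReal.ofReal_add hK0 (norm_nonneg _)]
      _ ≤ _ := by
        gcongr ENNReal.ofReal ?_ * _
        linarith
  have hξL : MemLinftyLoc ξ := by
    intro T
    refine ⟨hξm.mono_measure (Measure.restrict_mono Set.Icc_subset_Ici_self le_rfl), ?_⟩
    rw [eLpNorm_exponent_top]
    refine (eLpNormEssSup_le_of_ae_enorm_bound
      (C := ENNReal.ofReal K * eLpNorm u ∞ (volume.restrict (Set.Icc 0 T))) ?_).trans_lt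
      (ENNReal.mul_lt_top ENNReal.ofReal_lt_top (hu T).2)
    filter_upwards [ae_restrict_mem measurableSet_Icc] with s hs using hξb s T hs.1 hs.2
  have hfL : MemLinftyLoc fun s => ξ s + D (u s) := fun T =>
    ⟨(hξL T).1.add (D.continuous.comp_aestronglyMeasurable (hu T).1),
      (hbound T).trans_lt (ENNReal.mul_lt_top ENNReal.ofReal_lt_top (hu T).2)⟩
  refine ⟨fun s => ξ s + D (u s), hfL, fun φ => ?_, fun t _ => hbound t⟩
  obtain ⟨F, hF, hy⟩ := h.output
  rw [hy, ← integral_iteratedDerivWithin_two_apply hfL.integrableOn_Ioc φ]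
  refine setIntegral_congr_fun measurableSet_Ici fun t (ht : 0 ≤ t) => ?_
  obtain ⟨w, hw, hval⟩ := hF t ht
  rw [hval.eq_add hC hm, ← hD]
  congr 1
  -- The state integral is given in `X₋₁`; local boundedness of `ξ` lets it be formed in `X`, and
  -- injectivity of the embedding identifies the two.
  have hw' : w = ∫ s in (0 : ℝ)..t, (t - s) • ξ s := by
    apply N.S.incl_injective N.b
    rw [hw, ← C0Semigroup.inclL_apply, ← ContinuousLinearMap.intervalIntegral_comp_comm _
      (hξL.intervalIntegrable_sub_smul ht)]
    refine intervalIntegral.integral_congr fun s hs => ?_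
    rw [Set.uIcc_of_le ht] at hs
    rw [ContinuousLinearMap.map_smul_of_tower, C0Semigroup.inclL_apply, hξ s hs.1, hx s hs.1]
  have hDu : MemLinftyLoc fun s => D (u s) := fun T => D.comp_memLp' (hu T)
  rw [hw', ← ContinuousLinearMap.intervalIntegral_comp_comm _ (hu.intervalIntegrable_sub_smul ht),
    ← intervalIntegral.integral_add (hξL.intervalIntegrable_sub_smul ht)]
  · simp only [smul_add, ContinuousLinearMap.map_smul_of_tower]
  · simpa only [ContinuousLinearMap.map_smul_of_tower] using hDu.intervalIntegrable_sub_smul ht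

end SystemNode

theorem mainTheorem11 {U X : Type*}
    [NormedAddCommGroup U] [NormedSpace ℂ U] [CompleteSpace U]
    [NormedAddCommGroup X] [NormedSpace ℂ X] [CompleteSpace X]
    (N : SystemNode U X X) (hC : ∀ z : N.S.Interp N.b, N.C z = N.S.interpVal N.b z) :
    (N.S.InfiniteTimeControlAdmissible N.b N.B ∞ → N.LinftyBIBOStable) ∧
      ((∃ p : ℝ≥0∞, 1 ≤ p ∧ N.S.ControlAdmissible N.b N.B p) → N.S.ExponentiallyStable →
        N.LinftyBIBOStable) := by
  refine ⟨N.linftyBIBOStable_of_infiniteTimeControlAdmissible hC, ?_⟩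
  rintro ⟨p, -, hp⟩ hS
  exact N.linftyBIBOStable_of_infiniteTimeControlAdmissible hC
    (hp.infiniteTime_of_exponentiallyStable hS)
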